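/- **Setting.** Let $(\mathsf Z,\mathscr Z)$ be a measurable space, $P$ a stochastic kernel on it with $t$-step kernels $P^t$ ($P^0$ the identity kernel), and $(Z_t)_{t\ge 0}$ a time-homogeneous Markov process with transition kernel $P$ relative to a filtration $(\mathscr F_t)_{t\ge0}$, with $\mathbb P_z,\mathbb E_z$ the probability and expectation under which $Z_0=z$. Thus $\mathbb E_z|h(Z_t)|=\int |h(z')|\,P^t(z,dz')$ for measurable $h$. Let $\beta\in(0,1)$ and let $r,c:\mathsf Z\to\mathbb R$ be measurable (exit payoff and flow continuation payoff). Let $\mathscr M$ be the set of $(\mathscr F_t)$-stopping times $\tau$ that are almost surely finite, and let $$v^*(z)=\sup_{\tau\in\mathscr M}\mathbb E_z\Big[\sum_{t=0}^{\tau-1}\beta^t c(Z_t)+\beta^\tau r(Z_\tau)\Big],\qquad \psi^*(z)=c(z)+\beta\int v^*(z')P(z,dz').$$ For $\psi:\mathsf Z\to\mathbb R$ let $Q\psi(z)=c(z)+\beta\int\max\{r(z'),\psi(z')\}P(z,dz')$ (the Jovanovic operator). **Assumption.** There are a measurable $g:\mathsf Z\to\mathbb R_+$ and constants $n\in\{0,1,2,\dots\}$,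 $m,d\in\mathbb R_+$ with $\beta m<1$ such that for all $z\in\mathsf Z$ $$\max\Big\{\int|r(z')|P^n(z,dz'),\int|c(z')|P^n(z,dz')\Big\}\le g(z)\quad\text{and}\quad\int g(z')P(z,dz')\le m\,g(z)+d .$$ Let $m',d'>0$ satisfy $m+2m'>1$, $\beta(m+2m')<1$ and $d'\ge d/(m+2m'-1)$, and put $$\ell(z)=m'\Big(\sum_{t=1}^{n-1}\mathbb E_z|r(Z_t)|+\sum_{t=0}^{n-1}\mathbb E_z|c(Z_t)|\Big)+g(z)+d',$$ where it is assumed that $\ell$ is real-valued, i.e. that $\mathbb E_z|r(Z_t)|$ and $\mathbb E_z|c(Z_t)|$ are finite for all $z$ and all $1\le t\le n-1$. Let $b_\ell\mathsf Z$ be the space of measurable $f:\mathsf Z\to\mathbb R$ with $\|f\|_\ell=\sup_z|f(z)|/\ell(z)<\infty$. **Theorem.** All expectations, suprema and integrals below are well defined and finite, and: 1. $Q$ maps $b_\ell\mathsf Z$ into itself, and $\|Q\psi-Q\phi\|_\ell\le\beta(m+2m')\|\psi-\phi\|_\ell$ for all $\psi,\phi\in b_\ell\mathsf Z$; that is, $Q$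 is a contraction of modulus $\beta(m+2m')$ on $(b_\ell\mathsf Z,\|\cdot\|_\ell)$. 2. $\psi^*$ belongs to $b_\ell\mathsf Z$ and is the unique fixed point of $Q$ there. 3. The policy $\sigma^*(z)=\mathbf 1\{r(z)\ge\psi^*(z)\}$ is optimal: $\tau^*=\inf\{t\ge0:\sigma^*(Z_t)=1\}$ (with $\inf\emptyset=\infty$) is a stopping time that attains $v^*(z)$ for every $z$, and no stopping time, finite or not, has a larger expected payoff than $v^*(z)$, where on $\{\tau=\infty\}$ the payoff is $\sum_{t\ge0}\beta^tc(Z_t)$ (never stopping). In particular, if $\mathbb P_z\{\tau^*<\infty\}=1$ for all $z$, then $\tau^*\in\mathscr M$ and $\tau^*$ attains the supremum that defines $v^*(z)$ for every $z$. -/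

import Mathlib

open MeasureTheory ProbabilityTheory Set Filter

open scoped ENNReal

noncomputable section

namespace OptimalTiming

variable {Z : Type*} [MeasurableSpace Z]

/-! ### Weighted supremum norm -/

/-- The space `b_ℓ Z` of measurable functions `f` with `sup_z |f z| / ℓ z < ∞`. -/
def weightedBounded (ℓ : Z → ℝ) : Set (Z → ℝ) :=
  {f | Measurable f ∧ BddAbove (range fun z => |f z| / ℓ z)}

/-- The `ℓ`-weighted supremum norm `sup_z |f z| / ℓ z`. -/
def weightedNorm (ℓ : Z → ℝ) (f : Z → ℝ) : ℝ := ⨆ z, |f z| / ℓ z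

/-! ### Multi-step transitions, drift condition and weight function -/

/-- `E_z |f(Z_t)| = ∫ |f(z')| P^t(z, dz')`, as an extended nonnegative number. Here `P ^ t` is the
`t`-step transition kernel, the power of `P` for composition of kernels. -/
def absMoment (P : Kernel Z Z) (f : Z → ℝ) (t : ℕ) (z : Z) : ℝ≥0∞ :=
  ∫⁻ z', ENNReal.ofReal |f z'| ∂((P ^ t) z)

/-- The `n`-step expected absolute payoffs are dominated by `g`, which satisfies a geometric drift
condition with constants `m` and `d`, where `β m < 1`. -/
structure DriftCondition (P : Kernel Z Z) (β : ℝ) (r c : Z → ℝ) (g : Z → ℝ) (n : ℕ) (m d : ℝ) :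
    Prop where
  measurable_g : Measurable g
  g_nonneg : ∀ z, 0 ≤ g z
  m_nonneg : 0 ≤ m
  d_nonneg : 0 ≤ d
  discount : β * m < 1
  bound : ∀ z, max (absMoment P r n z) (absMoment P c n z) ≤ ENNReal.ofReal (g z)
  drift : ∀ z, ∫⁻ z', ENNReal.ofReal (g z') ∂(P z) ≤ ENNReal.ofReal (m * g z + d)

/-- The weight function
`ℓ(z) = m' (∑_{t=1}^{n-1} E_z |r(Z_t)| + ∑_{t=0}^{n-1} E_z |c(Z_t)|) + g(z) + d'`. -/
def weight (P : Kernel Z Z) (r c g : Z → ℝ) (n : ℕ) (m' d' : ℝ) (z : Z) : ℝ :=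
  m' * (∑ t ∈ Finset.Ico 1 n, (absMoment P r t z).toReal +
      ∑ t ∈ Finset.range n, (absMoment P c t z).toReal) + g z + d'

/-! ### The state process -/

variable {Ω : Type*} [mΩ : MeasurableSpace Ω]

/-- `X` is a time-homogeneous Markov process with transition kernel `P` relative to the filtration
`ℱ`, where `Pr z` is the probability under which the process starts at `z`. -/
structure IsMarkovFamily (P : Kernel Z Z) (ℱ : Filtration ℕ mΩ) (X : ℕ → Ω → Z)
    (Pr : Z → Measure Ω) : Prop where
  isProbabilityMeasure : ∀ z, IsProbabilityMeasure (Pr z)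
  adapted : ∀ t, Measurable[ℱ t] (X t)
  initial : ∀ z, (Pr z).map (X 0) = Measure.dirac z
  markov : ∀ (z : Z) (t : ℕ) (B : Set Z), MeasurableSet B →
    (Pr z)[(X (t + 1) ⁻¹' B).indicator (fun _ => (1 : ℝ)) | ℱ t]
      =ᵐ[Pr z] fun ω => (P (X t ω)).real B

/-! ### The stopping problem -/

/-- Discounted payoff along the path `x` when acting at time `k`, respectively never. -/
def pathPayoff (β : ℝ) (r c : Z → ℝ) (x : ℕ → Z) : WithTop ℕ → ℝ
  | ⊤ => ∑' t : ℕ, β ^ t * c (x t)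
  | (k : ℕ) => ∑ t ∈ Finset.range k, β ^ t * c (x t) + β ^ k * r (x k)

/-- The random discounted payoff of the stopping rule `τ`. -/
def payoff (β : ℝ) (r c : Z → ℝ) (X : ℕ → Ω → Z) (τ : Ω → WithTop ℕ) (ω : Ω) : ℝ :=
  pathPayoff β r c (fun t => X t ω) (τ ω)

/-- The set `ℳ` of (almost surely) finite stopping times. -/
def finiteStoppingTimes (ℱ : Filtration ℕ mΩ) (Pr : Z → Measure Ω) :
    Set (Ω → WithTop ℕ) :=
  {τ | IsStoppingTime ℱ τ ∧ ∀ z, ∀ᵐ ω ∂(Pr z), τ ω ≠ ⊤}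

/-- The set of expected payoffs, from the initial state `z`, of the finite stopping times. -/
def attainableValues (β : ℝ) (r c : Z → ℝ) (ℱ : Filtration ℕ mΩ) (X : ℕ → Ω → Z)
    (Pr : Z → Measure Ω) (z : Z) : Set ℝ :=
  {v | ∃ τ ∈ finiteStoppingTimes ℱ Pr, v = ∫ ω, payoff β r c X τ ω ∂(Pr z)}

/-- The value function `v*`. -/
def valueFn (β : ℝ) (r c : Z → ℝ) (ℱ : Filtration ℕ mΩ) (X : ℕ → Ω → Z)
    (Pr : Z → Measure Ω) (z : Z) : ℝ :=
  sSup (attainableValues β r c ℱ X Pr z)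

/-- The continuation value function `ψ* = c + β P v*`. -/
def continuationValue (P : Kernel Z Z) (β : ℝ) (r c : Z → ℝ)
    (ℱ : Filtration ℕ mΩ) (X : ℕ → Ω → Z) (Pr : Z → Measure Ω) (z : Z) : ℝ :=
  c z + β * ∫ z', valueFn β r c ℱ X Pr z' ∂(P z)

/-- The Jovanovic (continuation value) operator `Q ψ = c + β P (r ∨ ψ)`. -/
def jovanovic (P : Kernel Z Z) (β : ℝ) (r c : Z → ℝ) (ψ : Z → ℝ) (z : Z) : ℝ :=
  c z + β * ∫ z', max (r z') (ψ z') ∂(P z)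

/-- The stopping rule `inf {t ≥ 0 | σ(Z_t) = 1}` of a policy `σ` (`⊤` if the policy never stops). -/
def policyTime (X : ℕ → Ω → Z) (σ : Z → Fin 2) : Ω → WithTop ℕ :=
  hittingAfter X {z | σ z = 1} 0

/-- `σ` is an optimal policy: its stopping rule is a finite stopping time and attains the
supremum that defines the value function. -/
def IsOptimalPolicy (β : ℝ) (r c : Z → ℝ) (ℱ : Filtration ℕ mΩ) (X : ℕ → Ω → Z)
    (Pr : Z → Measure Ω) (σ : Z → Fin 2) : Prop :=
  policyTime X σ ∈ finiteStoppingTimes ℱ Pr ∧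
    ∀ z, ∫ ω, payoff β r c X (policyTime X σ) ω ∂(Pr z) = valueFn β r c ℱ X Pr z

/-- The policy `z ↦ 1{r z ≥ ψ z}`. -/
def thresholdPolicy (r ψ : Z → ℝ) (z : Z) : Fin 2 := if r z ≥ ψ z then 1 else 0

end OptimalTiming

end

open OptimalTiming

/-! Write `a = m + 2 m'` and `w = max r ψ`. The weight `ℓ` is built so that one transition
multiplies it by at most `a`, while `|c|` and the one-step mean of `|r|` are at most a constant
times `ℓ` (`DriftCondition.weightBounds`). As `x ↦ max r x` is 1-Lipschitz, `Q` contracts the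
weighted norm by `β a < 1`, and Picard iteration yields a fixed point `ψ` (`exists_jovanovic_eq`).

The fixed point is then verified against every stopping time `τ`. The payoff is cut into stages, and
the carried value at `t` is `V t = E[β^t w(Z_t); t ≤ τ]`. Since `ψ = c + β P w` and `{t < τ}` is
known at time `t`, the Markov property bounds the expected payoff of stage `t` by `V t - V (t + 1)`,
with equality if `τ` continues only where `r ≤ ψ` and stops only where `ψ ≤ r`. The sum telescopes
from `V 0 = w z`, and `V N → 0` because discounted moments are summable. Hence no rule earns more
than `w z` and the threshold rule earns exactly that (`integral_payoff_le`, `integral_payoff_eq`).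

The threshold rule may never stop, but its truncations are finite rules whose payoffs converge to
its own, so the supremum over finite rules is still `w z`. Thus `v* = max r ψ`, and `ψ* = c + β P v*
= Q ψ = ψ`. -/

namespace OptimalTiming

open scoped Topology

/-! ### Weighted bounds and the Jovanovic operator -/

/-- One-step bounds on the payoffs and on the weight `ℓ` in terms of `ℓ`. -/
structure WeightBounds {Z : Type*} [MeasurableSpace Z] (P : Kernel Z Z) (r c ℓ : Z → ℝ)
    (K a : ℝ) : Prop where
  K_nonneg : 0 ≤ K
  a_nonneg : 0 ≤ a
  measurable_exit : Measurable r
  measurable_flow : Measurable c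
  measurable : Measurable ℓ
  pos : ∀ z, 0 < ℓ z
  -- Only the mean of `|r|` after one transition is controlled: for `n ≥ 1` the exit sum in `weight`
  -- starts at `t = 1`, so `r` itself need not be bounded by `ℓ`.
  integrable_exit : ∀ z, Integrable r (P z)
  integral_exit_le : ∀ z, ∫ z', |r z'| ∂(P z) ≤ K * ℓ z
  flow_le : ∀ z, |c z| ≤ K * ℓ z
  integrable : ∀ z, Integrable ℓ (P z)
  integral_le : ∀ z, ∫ z', ℓ z' ∂(P z) ≤ a * ℓ z

section Weighted

variable {Z : Type*} [MeasurableSpace Z]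

lemma mem_weightedBounded_iff {ℓ f : Z → ℝ} (hℓ : ∀ z, 0 < ℓ z) :
    f ∈ weightedBounded ℓ ↔ Measurable f ∧ ∃ C, 0 ≤ C ∧ ∀ z, |f z| ≤ C * ℓ z := by
  refine and_congr_right fun _ => ⟨?_, ?_⟩
  · rintro ⟨C, hC⟩
    refine ⟨max C 0, le_max_right _ _, fun z => (div_le_iff₀ (hℓ z)).1 ?_⟩
    exact (hC ⟨z, rfl⟩).trans (le_max_left _ _)
  · rintro ⟨C, -, hC⟩
    refine ⟨C, ?_⟩
    rintro _ ⟨z, rfl⟩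
    exact (div_le_iff₀ (hℓ z)).2 (hC z)

lemma weightedNorm_nonneg {Y : Type*} {ℓ : Y → ℝ} (hℓ : ∀ y, 0 < ℓ y) (f : Y → ℝ) :
    0 ≤ weightedNorm ℓ f :=
  Real.iSup_nonneg fun z => div_nonneg (abs_nonneg _) (hℓ z).le

lemma abs_le_weightedNorm_mul {ℓ f : Z → ℝ} (hℓ : ∀ z, 0 < ℓ z) (hf : f ∈ weightedBounded ℓ)
    (z : Z) : |f z| ≤ weightedNorm ℓ f * ℓ z :=
  (div_le_iff₀ (hℓ z)).1 (le_ciSup hf.2 z)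

lemma sub_mem_weightedBounded {ℓ f h : Z → ℝ} (hℓ : ∀ z, 0 < ℓ z) (hf : f ∈ weightedBounded ℓ)
    (hh : h ∈ weightedBounded ℓ) : f - h ∈ weightedBounded ℓ := by
  rw [mem_weightedBounded_iff hℓ] at *
  obtain ⟨mf, C, hC, bf⟩ := hf
  obtain ⟨mh, D, hD, bh⟩ := hh
  refine ⟨mf.sub mh, C + D, add_nonneg hC hD, fun z => ?_⟩
  calc |f z - h z| ≤ |f z| + |h z| := abs_sub _ _
    _ ≤ (C + D) * ℓ z := by linarith [bf z, bh z]

namespace WeightBounds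

variable {P : Kernel Z Z} {r c ℓ : Z → ℝ} {K a : ℝ}

lemma integrable_of_abs_le (hW : WeightBounds P r c ℓ K a) {f : Z → ℝ} (mf : Measurable f)
    {C : ℝ} (hf : ∀ z, |f z| ≤ C * ℓ z) (z : Z) : Integrable f (P z) :=
  ((hW.integrable z).const_mul C).mono' mf.aestronglyMeasurable (Eventually.of_forall hf)

lemma integrable_of_mem (hW : WeightBounds P r c ℓ K a) {f : Z → ℝ}
    (hf : f ∈ weightedBounded ℓ) (z : Z) : Integrable f (P z) := by
  obtain ⟨mf, C, -, hC⟩ := (mem_weightedBounded_iff hW.pos).1 hf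
  exact hW.integrable_of_abs_le mf hC z

lemma integrable_max (hW : WeightBounds P r c ℓ K a) {f : Z → ℝ}
    (hf : f ∈ weightedBounded ℓ) (z : Z) : Integrable (fun z' => max (r z') (f z')) (P z) :=
  (hW.integrable_exit z).sup (hW.integrable_of_mem hf z)

lemma abs_max_le {x y : ℝ} : |max x y| ≤ |x| + |y| := by
  rcases max_choice x y with h | h <;> rw [h] <;> linarith [abs_nonneg x, abs_nonneg y]

lemma integral_abs_max_le (hW : WeightBounds P r c ℓ K a) {f : Z → ℝ} (mf : Measurable f)
    {C : ℝ} (hC : 0 ≤ C) (hf : ∀ z, |f z| ≤ C * ℓ z) (z : Z) :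
    ∫ z', |max (r z') (f z')| ∂(P z) ≤ (K + C * a) * ℓ z := by
  have hfi := hW.integrable_of_abs_le mf hf z
  calc ∫ z', |max (r z') (f z')| ∂(P z)
      ≤ ∫ z', (|r z'| + C * ℓ z') ∂(P z) := by
        refine integral_mono ((hW.integrable_exit z).sup hfi).abs
          ((hW.integrable_exit z).abs.add ((hW.integrable z).const_mul C)) fun z' => ?_
        exact abs_max_le.trans (by simpa using hf z')
    _ = ∫ z', |r z'| ∂(P z) + C * ∫ z', ℓ z' ∂(P z) := by
        rw [integral_add (hW.integrable_exit z).abs ((hW.integrable z).const_mul C),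
          integral_const_mul]
    _ ≤ K * ℓ z + C * (a * ℓ z) :=
        add_le_add (hW.integral_exit_le z) (mul_le_mul_of_nonneg_left (hW.integral_le z) hC)
    _ = (K + C * a) * ℓ z := by ring

/-- `x ↦ max r x` is 1-Lipschitz, so the only factors are `a` from integrating `ℓ` and `β` from
discounting. The free constant `C` serves both the norm estimate and the Picard iterates. -/
lemma abs_jovanovic_sub_le (hW : WeightBounds P r c ℓ K a) {β : ℝ} (hβ : 0 ≤ β) {f h : Z → ℝ}
    (hf : f ∈ weightedBounded ℓ) (hh : h ∈ weightedBounded ℓ) {C : ℝ} (hC : 0 ≤ C)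
    (hfh : ∀ z, |f z - h z| ≤ C * ℓ z) (z : Z) :
    |jovanovic P β r c f z - jovanovic P β r c h z| ≤ β * a * C * ℓ z := by
  have hi := (hW.integrable_max hf z).sub (hW.integrable_max hh z)
  have h1 : |∫ z', (max (r z') (f z') - max (r z') (h z')) ∂(P z)| ≤ C * (a * ℓ z) :=
    calc |∫ z', (max (r z') (f z') - max (r z') (h z')) ∂(P z)|
        ≤ ∫ z', |max (r z') (f z') - max (r z') (h z')| ∂(P z) := abs_integral_le_integral_abs
      _ ≤ ∫ z', C * ℓ z' ∂(P z) := by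
          refine integral_mono hi.abs ((hW.integrable z).const_mul C) fun z' => ?_
          refine le_trans ?_ (hfh z')
          have := abs_max_sub_max_le_max (r z') (f z') (r z') (h z')
          simpa using this
      _ ≤ C * (a * ℓ z) := by
          rw [integral_const_mul]
          exact mul_le_mul_of_nonneg_left (hW.integral_le z) hC
  have h2 : jovanovic P β r c f z - jovanovic P β r c h z
      = β * ∫ z', (max (r z') (f z') - max (r z') (h z')) ∂(P z) := by
    rw [integral_sub (hW.integrable_max hf z) (hW.integrable_max hh z)]
    simp only [jovanovic]
    ring
  rw [h2, abs_mul, abs_of_nonneg hβ]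
  calc _ ≤ β * (C * (a * ℓ z)) := mul_le_mul_of_nonneg_left h1 hβ
    _ = β * a * C * ℓ z := by ring

lemma jovanovic_mem (hW : WeightBounds P r c ℓ K a) {β : ℝ} (hβ : 0 ≤ β) {f : Z → ℝ}
    (hf : f ∈ weightedBounded ℓ) : jovanovic P β r c f ∈ weightedBounded ℓ := by
  obtain ⟨mf, C, hC, bf⟩ := (mem_weightedBounded_iff hW.pos).1 hf
  refine (mem_weightedBounded_iff hW.pos).2 ⟨?_, K + β * (K + C * a), ?_, fun z => ?_⟩
  · exact hW.measurable_flow.add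
      ((hW.measurable_exit.max mf).stronglyMeasurable.integral_kernel.measurable.const_mul β)
  · have := hW.K_nonneg
    have := hW.a_nonneg
    positivity
  · calc |jovanovic P β r c f z| ≤ |c z| + |β * ∫ z', max (r z') (f z') ∂(P z)| := abs_add_le _ _
      _ ≤ K * ℓ z + β * ((K + C * a) * ℓ z) := by
          rw [abs_mul, abs_of_nonneg hβ]
          refine add_le_add (hW.flow_le z) (mul_le_mul_of_nonneg_left ?_ hβ)
          exact abs_integral_le_integral_abs.trans (hW.integral_abs_max_le mf hC bf z)
      _ = (K + β * (K + C * a)) * ℓ z := by ring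

lemma weightedNorm_jovanovic_sub_le (hW : WeightBounds P r c ℓ K a) {β : ℝ} (hβ : 0 ≤ β)
    {f h : Z → ℝ} (hf : f ∈ weightedBounded ℓ) (hh : h ∈ weightedBounded ℓ) :
    weightedNorm ℓ (jovanovic P β r c f - jovanovic P β r c h)
      ≤ β * a * weightedNorm ℓ (f - h) := by
  have hN := weightedNorm_nonneg hW.pos (f - h)
  -- The bound must be nonnegative because a real supremum over an empty type is `0`.
  refine Real.iSup_le (fun z => (div_le_iff₀ (hW.pos z)).2 ?_)
    (mul_nonneg (mul_nonneg hβ hW.a_nonneg) hN)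
  exact hW.abs_jovanovic_sub_le hβ hf hh hN
    (abs_le_weightedNorm_mul hW.pos (sub_mem_weightedBounded hW.pos hf hh)) z

lemma eq_of_jovanovic_eq (hW : WeightBounds P r c ℓ K a) {β : ℝ} (hβ : 0 ≤ β) (hβa : β * a < 1)
    {f h : Z → ℝ} (hf : f ∈ weightedBounded ℓ) (hh : h ∈ weightedBounded ℓ)
    (ef : jovanovic P β r c f = f) (eh : jovanovic P β r c h = h) : f = h := by
  have h1 := hW.weightedNorm_jovanovic_sub_le hβ hf hh
  rw [ef, eh] at h1
  have h2 : weightedNorm ℓ (f - h) = 0 := by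
    nlinarith [weightedNorm_nonneg hW.pos (f - h)]
  funext z
  have h3 := abs_le_weightedNorm_mul hW.pos (sub_mem_weightedBounded hW.pos hf hh) z
  rw [h2, zero_mul] at h3
  exact sub_eq_zero.1 (abs_nonpos_iff.1 h3)

/-- Completeness of the weighted space is not used: the iterates from `0` are Cauchy in `ℝ` at each
point, with a geometric error proportional to `ℓ z`. This uniformity puts the limit in the space and
lets `Q` pass to it. -/
theorem exists_jovanovic_eq (hW : WeightBounds P r c ℓ K a) {β : ℝ} (hβ : 0 ≤ β)
    (hβa : β * a < 1) : ∃ f ∈ weightedBounded ℓ, jovanovic P β r c f = f := by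
  set Q := jovanovic P β r c with hQ
  set u : ℕ → Z → ℝ := fun k => Q^[k] 0 with hu
  have hρ : 0 ≤ β * a := mul_nonneg hβ hW.a_nonneg
  have u_succ : ∀ k, u (k + 1) = Q (u k) := fun k => Function.iterate_succ_apply' Q k 0
  have u_mem : ∀ k, u k ∈ weightedBounded ℓ := by
    intro k
    induction k with
    | zero =>
      exact (mem_weightedBounded_iff hW.pos).2 ⟨measurable_const, 0, le_rfl, fun z => by simp [hu]⟩
    | succ k ih => rw [u_succ]; exact hW.jovanovic_mem hβ ih
  obtain ⟨-, C, hC, bC⟩ := (mem_weightedBounded_iff hW.pos).1 (u_mem 1)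
  have step : ∀ k z, dist (u k z) (u (k + 1) z) ≤ C * ℓ z * (β * a) ^ k := by
    intro k
    induction k with
    | zero => intro z; simpa [hu, Real.dist_eq] using bC z
    | succ k ih =>
      intro z
      have := hW.abs_jovanovic_sub_le hβ (u_mem k) (u_mem (k + 1)) (C := C * (β * a) ^ k)
        (by positivity) (fun z => by
          have := ih z
          rw [Real.dist_eq] at this
          linarith) z
      rw [u_succ k, u_succ (k + 1), Real.dist_eq, u_succ k]
      rw [u_succ k] at this
      calc _ ≤ _ := this
        _ = _ := by ring
  have cau : ∀ z, ∃ x, Tendsto (fun k => u k z) atTop (𝓝 x) := fun z =>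
    cauchySeq_tendsto_of_complete (cauchySeq_of_le_geometric _ _ hβa (step · z))
  choose f hf using cau
  have bnd : ∀ k z, |u k z - f z| ≤ (C / (1 - β * a)) * (β * a) ^ k * ℓ z := by
    intro k z
    have := dist_le_of_le_geometric_of_tendsto _ _ hβa (step · z) (hf z) k
    rw [Real.dist_eq] at this
    calc _ ≤ _ := this
      _ = _ := by ring
  have hD : 0 ≤ C / (1 - β * a) := div_nonneg hC (by linarith)
  have f_mem : f ∈ weightedBounded ℓ := by
    refine (mem_weightedBounded_iff hW.pos).2
      ⟨measurable_of_tendsto_metrizable (fun k => (u_mem k).1) (tendsto_pi_nhds.2 hf),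
        C / (1 - β * a), hD, fun z => ?_⟩
    simpa [hu] using bnd 0 z
  refine ⟨f, f_mem, funext fun z => ?_⟩
  refine tendsto_nhds_unique ?_ ((tendsto_add_atTop_iff_nat 1).2 (hf z))
  have lim : Tendsto (fun k => β * a * (C / (1 - β * a) * (β * a) ^ k) * ℓ z) atTop (𝓝 0) := by
    have := ((tendsto_pow_atTop_nhds_zero_of_lt_one hρ hβa).const_mul
      (C / (1 - β * a))).const_mul (β * a) |>.mul_const (ℓ z)
    simpa using this
  rw [tendsto_iff_dist_tendsto_zero]
  refine squeeze_zero (fun _ => dist_nonneg) (fun k => ?_) lim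
  rw [u_succ, Real.dist_eq]
  exact hW.abs_jovanovic_sub_le hβ (u_mem k) f_mem (by positivity) (bnd k) z

end WeightBounds

end Weighted

/-! ### The weight function of the drift condition -/

section Drift

variable {Z : Type*} [MeasurableSpace Z]

lemma measurable_absMoment (P : Kernel Z Z) {f : Z → ℝ} (hf : Measurable f) (t : ℕ) :
    Measurable (absMoment P f t) :=
  Measurable.lintegral_kernel (by fun_prop)

lemma absMoment_zero (P : Kernel Z Z) {f : Z → ℝ} (hf : Measurable f) (z : Z) :
    absMoment P f 0 z = ENNReal.ofReal |f z| := by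
  have h : (P ^ 0) z = Measure.dirac z := by
    rw [pow_zero]
    exact Kernel.id_apply z
  rw [absMoment, h, lintegral_dirac' _ (by fun_prop)]

lemma absMoment_one (P : Kernel Z Z) (f : Z → ℝ) (z : Z) :
    absMoment P f 1 z = ∫⁻ z', ENNReal.ofReal |f z'| ∂(P z) := by
  rw [absMoment, pow_one]

/-- Chapman–Kolmogorov, with the extra transition taken first. -/
lemma lintegral_absMoment (P : Kernel Z Z) {f : Z → ℝ} (hf : Measurable f) (t : ℕ) (z : Z) :
    ∫⁻ z', absMoment P f t z' ∂(P z) = absMoment P f (t + 1) z := by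
  have h : (P ^ (t + 1)) z = ((P ^ t) ∘ₖ P) z := by rw [pow_succ]; rfl
  rw [absMoment, h, Kernel.lintegral_comp _ _ _ (by fun_prop)]
  rfl

variable {P : Kernel Z Z} {β : ℝ} {r c g : Z → ℝ} {n : ℕ} {m d m' d' : ℝ}

/-- The weight function as an extended nonnegative number. -/
noncomputable def weightENN (P : Kernel Z Z) (r c g : Z → ℝ) (n : ℕ) (m' d' : ℝ) (z : Z) :
    ℝ≥0∞ :=
  ENNReal.ofReal m' * (∑ t ∈ Finset.Ico 1 n, absMoment P r t z +
      ∑ t ∈ Finset.range n, absMoment P c t z) + ENNReal.ofReal (g z) + ENNReal.ofReal d'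

/-- Finite moments make `toReal` lossless. The flow moment at `t = 0` is `|c z|`, so finiteness has
to be assumed only from `t = 1`. -/
lemma ofReal_weight (hc : Measurable c) (hg : ∀ z, 0 ≤ g z) (hm' : 0 < m') (hd' : 0 < d')
    (hfin : ∀ z, ∀ t ∈ Finset.Ico 1 n, absMoment P r t z ≠ ∞ ∧ absMoment P c t z ≠ ∞) (z : Z) :
    ENNReal.ofReal (weight P r c g n m' d' z) = weightENN P r c g n m' d' z := by
  have fc : ∀ t ∈ Finset.range n, absMoment P c t z ≠ ∞ := by
    intro t ht
    rcases Nat.eq_zero_or_pos t with rfl | h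
    · rw [absMoment_zero P hc]; exact ENNReal.ofReal_ne_top
    · exact (hfin z t (Finset.mem_Ico.2 ⟨h, Finset.mem_range.1 ht⟩)).2
  have fr : ∀ t ∈ Finset.Ico 1 n, absMoment P r t z ≠ ∞ := fun t ht => (hfin z t ht).1
  have e : weight P r c g n m' d' z = (weightENN P r c g n m' d' z).toReal := by
    have h1 := ENNReal.sum_ne_top.2 fr
    have h2 := ENNReal.sum_ne_top.2 fc
    rw [weightENN, ENNReal.toReal_add, ENNReal.toReal_add, ENNReal.toReal_mul,
      ENNReal.toReal_add h1 h2, ENNReal.toReal_sum fr, ENNReal.toReal_sum fc,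
      ENNReal.toReal_ofReal hm'.le, ENNReal.toReal_ofReal hd'.le, ENNReal.toReal_ofReal (hg z), weight]
    all_goals finiteness
  rw [e, ENNReal.ofReal_toReal]
  have h1 := ENNReal.sum_ne_top.2 fr
  have h2 := ENNReal.sum_ne_top.2 fc
  rw [weightENN]
  finiteness

lemma lintegral_weightENN [IsMarkovKernel P] (hr : Measurable r) (hc : Measurable c)
    (hg : Measurable g) (z : Z) :
    ∫⁻ z', weightENN P r c g n m' d' z' ∂(P z) =
      ENNReal.ofReal m' * (∑ t ∈ Finset.Ico 1 n, absMoment P r (t + 1) z +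
      ∑ t ∈ Finset.range n, absMoment P c (t + 1) z) + ∫⁻ z', ENNReal.ofReal (g z') ∂(P z)
      + ENNReal.ofReal d' := by
  have mr := fun t => measurable_absMoment P hr t
  have mc := fun t => measurable_absMoment P hc t
  simp only [weightENN]
  rw [lintegral_add_right _ measurable_const, lintegral_add_right _ (by fun_prop),
    lintegral_const_mul _ (by fun_prop), lintegral_add_right _ (by fun_prop),
    lintegral_finsetSum _ (by fun_prop), lintegral_finsetSum _ (by fun_prop)]
  simp [lintegral_absMoment P hr, lintegral_absMoment P hc]

end Drift

/-! ### One-step inequalities for the weight -/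

section DriftBounds

variable {Z : Type*} [MeasurableSpace Z]
  {P : Kernel Z Z} {β : ℝ} {r c g : Z → ℝ} {n : ℕ} {m d m' d' : ℝ}

/-- A transition shifts each sum by one step, and each new last term, at time `n`, is at most `g`.
The two sums thus add `2 m' g`, and the drift of `g` adds `m g + d`. The condition on `d'` says that
`d + d' ≤ (m + 2 m') d'`, which absorbs the constants. -/
lemma DriftCondition.lintegral_weightENN_le [IsMarkovKernel P]
    (h : DriftCondition P β r c g n m d) (hr : Measurable r)
    (hc : Measurable c) (hm' : 0 < m') (hd' : 0 < d') (hm1 : 1 < m + 2 * m')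
    (hd : d / (m + 2 * m' - 1) ≤ d') (z : Z) :
    ∫⁻ z', weightENN P r c g n m' d' z' ∂(P z) ≤
      ENNReal.ofReal (m + 2 * m') * weightENN P r c g n m' d' z := by
  have hd2 : d ≤ d' * (m + 2 * m' - 1) := (div_le_iff₀ (by linarith)).1 hd
  have hg := h.g_nonneg z
  have hm := h.m_nonneg
  have hd0 := h.d_nonneg
  have exit_le : ∑ t ∈ Finset.Ico 1 n, absMoment P r (t + 1) z ≤
      ∑ t ∈ Finset.Ico 1 n, absMoment P r t z + ENNReal.ofReal (g z) := by
    rcases Nat.eq_zero_or_pos n with rfl | hn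
    · simp
    · rw [Finset.sum_Ico_add' (fun t => absMoment P r t z) 1 n 1]
      calc _ ≤ ∑ t ∈ Finset.Ico 1 (n + 1), absMoment P r t z :=
            Finset.sum_le_sum_of_subset (Finset.Ico_subset_Ico_left (by norm_num))
        _ = ∑ t ∈ Finset.Ico 1 n, absMoment P r t z + absMoment P r n z :=
            Finset.sum_Ico_succ_top hn _
        _ ≤ _ := by gcongr; exact (le_max_left _ _).trans (h.bound z)
  have flow_le : ∑ t ∈ Finset.range n, absMoment P c (t + 1) z ≤
      ∑ t ∈ Finset.range n, absMoment P c t z + ENNReal.ofReal (g z) := by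
    calc _ ≤ ∑ t ∈ Finset.range n, absMoment P c (t + 1) z + absMoment P c 0 z := le_self_add
      _ = ∑ t ∈ Finset.range n, absMoment P c t z + absMoment P c n z := by
          rw [← Finset.sum_range_succ' (fun t => absMoment P c t z) n, Finset.sum_range_succ]
      _ ≤ _ := by gcongr; exact (le_max_right _ _).trans (h.bound z)
  have scalar : ENNReal.ofReal m' * (ENNReal.ofReal (g z) + ENNReal.ofReal (g z))
      + ENNReal.ofReal (m * g z + d) + ENNReal.ofReal d' ≤
      ENNReal.ofReal (m + 2 * m') * (ENNReal.ofReal (g z) + ENNReal.ofReal d') := by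
    rw [← ENNReal.ofReal_add hg hg, ← ENNReal.ofReal_mul hm'.le, ← ENNReal.ofReal_add hg hd'.le,
      ← ENNReal.ofReal_mul (by linarith), ← ENNReal.ofReal_add (by positivity) (by positivity),
      ← ENNReal.ofReal_add (by positivity) (by positivity)]
    apply ENNReal.ofReal_le_ofReal
    nlinarith
  have one_le : 1 ≤ ENNReal.ofReal (m + 2 * m') := by
    rw [← ENNReal.ofReal_one]; exact ENNReal.ofReal_le_ofReal hm1.le
  rw [lintegral_weightENN hr hc h.measurable_g, weightENN]
  set A := ∑ t ∈ Finset.Ico 1 n, absMoment P r t z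
  set B := ∑ t ∈ Finset.range n, absMoment P c t z
  set G := ENNReal.ofReal (g z)
  calc _ ≤ ENNReal.ofReal m' * ((A + G) + (B + G)) + ENNReal.ofReal (m * g z + d)
        + ENNReal.ofReal d' := by gcongr; exact h.drift z
    _ = ENNReal.ofReal m' * (A + B) + (ENNReal.ofReal m' * (G + G)
        + ENNReal.ofReal (m * g z + d) + ENNReal.ofReal d') := by ring
    _ ≤ ENNReal.ofReal (m + 2 * m') * (ENNReal.ofReal m' * (A + B)) +
        ENNReal.ofReal (m + 2 * m') * (G + ENNReal.ofReal d') :=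
        add_le_add (le_mul_of_one_le_left zero_le one_le) scalar
    _ = _ := by ring

/-- The constant adds up those of three cases. For `n = 0`, `|r| ≤ g` and the drift of the weight
costs `m + 2 m'`; for `n = 1`, the moment is at most `g`, at cost `1`; for `n ≥ 2`, it is a term of
the weight with coefficient `m'`, at cost `1 / m'`. -/
lemma DriftCondition.lintegral_exit_le [IsMarkovKernel P]
    (h : DriftCondition P β r c g n m d) (hr : Measurable r)
    (hc : Measurable c) (hm' : 0 < m') (hd' : 0 < d') (hm1 : 1 < m + 2 * m')
    (hd : d / (m + 2 * m' - 1) ≤ d') (z : Z) :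
    ∫⁻ z', ENNReal.ofReal |r z'| ∂(P z) ≤
      ENNReal.ofReal (m'⁻¹ + 1 + (m + 2 * m')) * weightENN P r c g n m' d' z := by
  have hi : 0 < m'⁻¹ := inv_pos.2 hm'
  rcases Nat.lt_trichotomy n 1 with hn | rfl | hn
  · obtain rfl : n = 0 := by omega
    calc ∫⁻ z', ENNReal.ofReal |r z'| ∂(P z)
        ≤ ∫⁻ z', weightENN P r c g 0 m' d' z' ∂(P z) := by
          refine lintegral_mono fun z' => ?_
          rw [← absMoment_zero P hr]
          exact ((le_max_left _ _).trans (h.bound z')).trans (le_add_self.trans le_self_add)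
      _ ≤ _ := h.lintegral_weightENN_le hr hc hm' hd' hm1 hd z
      _ ≤ _ := mul_le_mul' (ENNReal.ofReal_le_ofReal (by linarith)) le_rfl
  · rw [← absMoment_one]
    calc absMoment P r 1 z ≤ ENNReal.ofReal (g z) := (le_max_left _ _).trans (h.bound z)
      _ ≤ weightENN P r c g 1 m' d' z := le_add_self.trans le_self_add
      _ = ENNReal.ofReal 1 * weightENN P r c g 1 m' d' z := by simp
      _ ≤ _ := by gcongr; linarith
  · rw [← absMoment_one]
    calc absMoment P r 1 z = ENNReal.ofReal m'⁻¹ * (ENNReal.ofReal m' * absMoment P r 1 z) := by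
          rw [← mul_assoc, ← ENNReal.ofReal_mul hi.le, inv_mul_cancel₀ hm'.ne']; simp
      _ ≤ ENNReal.ofReal m'⁻¹ * weightENN P r c g n m' d' z := by
          gcongr
          refine le_trans ?_ (le_self_add.trans le_self_add)
          gcongr
          exact (Finset.single_le_sum (f := fun t => absMoment P r t z) (fun _ _ => zero_le)
            (Finset.mem_Ico.2 ⟨le_rfl, hn⟩)).trans le_self_add
      _ ≤ _ := by gcongr; linarith

lemma DriftCondition.flow_le
    (h : DriftCondition P β r c g n m d) (hc : Measurable c) (hm' : 0 < m')
    (hm1 : 1 < m + 2 * m') (z : Z) :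
    ENNReal.ofReal |c z| ≤
      ENNReal.ofReal (m'⁻¹ + 1 + (m + 2 * m')) * weightENN P r c g n m' d' z := by
  have hi : 0 < m'⁻¹ := inv_pos.2 hm'
  rw [← absMoment_zero P hc]
  rcases Nat.eq_zero_or_pos n with rfl | hn
  · calc absMoment P c 0 z ≤ ENNReal.ofReal (g z) := (le_max_right _ _).trans (h.bound z)
      _ ≤ weightENN P r c g 0 m' d' z := le_add_self.trans le_self_add
      _ = ENNReal.ofReal 1 * weightENN P r c g 0 m' d' z := by simp
      _ ≤ _ := by gcongr; linarith
  · calc absMoment P c 0 z = ENNReal.ofReal m'⁻¹ * (ENNReal.ofReal m' * absMoment P c 0 z) := by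
          rw [← mul_assoc, ← ENNReal.ofReal_mul hi.le, inv_mul_cancel₀ hm'.ne']; simp
      _ ≤ ENNReal.ofReal m'⁻¹ * weightENN P r c g n m' d' z := by
          gcongr
          refine le_trans ?_ (le_self_add.trans le_self_add)
          gcongr
          exact (Finset.single_le_sum (f := fun t => absMoment P c t z) (fun _ _ => zero_le)
            (Finset.mem_range.2 hn)).trans le_add_self
      _ ≤ _ := by gcongr; linarith

lemma integrable_and_integral_abs_le {α : Type*} [MeasurableSpace α] {μ : Measure α} {f : α → ℝ}
    (hf : Measurable f) {C : ℝ} (hC : 0 ≤ C)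
    (h : ∫⁻ x, ENNReal.ofReal |f x| ∂μ ≤ ENNReal.ofReal C) :
    Integrable f μ ∧ ∫ x, |f x| ∂μ ≤ C := by
  refine ⟨⟨hf.aestronglyMeasurable, ?_⟩, ?_⟩
  · rw [hasFiniteIntegral_iff_norm]
    exact h.trans_lt ENNReal.ofReal_lt_top
  · rw [integral_eq_lintegral_of_nonneg_ae (Eventually.of_forall fun _ => abs_nonneg _)
      (by fun_prop)]
    exact ENNReal.toReal_le_of_le_ofReal hC h

theorem DriftCondition.weightBounds [IsMarkovKernel P]
    (h : DriftCondition P β r c g n m d) (hr : Measurable r)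
    (hc : Measurable c) (hm' : 0 < m') (hd' : 0 < d') (hm1 : 1 < m + 2 * m')
    (hd : d / (m + 2 * m' - 1) ≤ d')
    (hfin : ∀ z, ∀ t ∈ Finset.Ico 1 n, absMoment P r t z ≠ ∞ ∧ absMoment P c t z ≠ ∞) :
    WeightBounds P r c (weight P r c g n m' d') (m'⁻¹ + 1 + (m + 2 * m')) (m + 2 * m') := by
  have hi : 0 < m'⁻¹ := inv_pos.2 hm'
  have hK : 0 ≤ m'⁻¹ + 1 + (m + 2 * m') := by linarith
  have ha : 0 ≤ m + 2 * m' := by linarith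
  have eW := ofReal_weight (P := P) hc h.g_nonneg hm' hd' hfin
  have pos : ∀ z, 0 < weight P r c g n m' d' z := fun z => by
    have := h.g_nonneg z
    rw [weight]
    positivity
  have meas : Measurable (weight P r c g n m' d') := by
    have mr := fun t => measurable_absMoment P hr t
    have mc := fun t => measurable_absMoment P hc t
    have mg := h.measurable_g
    unfold weight
    fun_prop
  have exit := fun z => integrable_and_integral_abs_le hr (mul_nonneg hK (pos z).le)
    (by rw [ENNReal.ofReal_mul hK, eW]; exact h.lintegral_exit_le hr hc hm' hd' hm1 hd z)
  have self := fun z => integrable_and_integral_abs_le meas (mul_nonneg ha (pos z).le) (μ := P z)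
    (by
      simp_rw [abs_of_pos (pos _)]
      rw [ENNReal.ofReal_mul ha, eW]
      simp_rw [eW]
      exact h.lintegral_weightENN_le hr hc hm' hd' hm1 hd z)
  refine ⟨hK, ha, hr, hc, meas, pos, fun z => (exit z).1, fun z => (exit z).2, fun z => ?_,
    fun z => (self z).1, fun z => ?_⟩
  · refine (ENNReal.ofReal_le_ofReal_iff (mul_nonneg hK (pos z).le)).1 ?_
    rw [ENNReal.ofReal_mul hK, eW]
    exact h.flow_le hc hm' hm1 z
  · simpa only [abs_of_pos (pos _)] using (self z).2

end DriftBounds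

/-! ### Integrable series -/

section Series

variable {α : Type*} [MeasurableSpace α] {μ : Measure α} {F : ℕ → α → ℝ}

lemma lintegral_tsum_enorm_ne_top (hF : ∀ i, Integrable (F i) μ)
    (hs : Summable fun i => ∫ x, |F i x| ∂μ) : ∫⁻ x, ∑' i, ‖F i x‖ₑ ∂μ ≠ ∞ := by
  rw [lintegral_tsum fun i => (hF i).1.enorm]
  have e : ∀ i, ∫⁻ x, ‖F i x‖ₑ ∂μ = ENNReal.ofReal (∫ x, |F i x| ∂μ) := fun i => by
    rw [ofReal_integral_eq_lintegral_ofReal (hF i).abs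
      (Eventually.of_forall fun _ => abs_nonneg _)]
    simp_rw [Real.enorm_eq_ofReal_abs]
  simp_rw [e]
  rw [← ENNReal.ofReal_tsum_of_nonneg (fun i => integral_nonneg fun _ => abs_nonneg _) hs]
  exact ENNReal.ofReal_ne_top

lemma ae_summable_abs_of_summable_integral (hF : ∀ i, Integrable (F i) μ)
    (hs : Summable fun i => ∫ x, |F i x| ∂μ) : ∀ᵐ x ∂μ, Summable fun i => |F i x| := by
  filter_upwards [ae_lt_top' (AEMeasurable.tsum fun i => (hF i).1.enorm)
    (lintegral_tsum_enorm_ne_top hF hs)] with x hx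
  simp_rw [← Real.norm_eq_abs]
  exact tsum_enorm_ne_top_iff_summable_norm.1 hx.ne

/-- Nothing is assumed on the measurability of `f`: it is inherited from the partial sums as an a.e.
limit. -/
lemma integrable_of_hasSum (hF : ∀ i, Integrable (F i) μ)
    (hs : Summable fun i => ∫ x, |F i x| ∂μ) {f : α → ℝ}
    (hf : ∀ᵐ x ∂μ, HasSum (fun i => F i x) (f x)) : Integrable f μ := by
  refine ⟨aestronglyMeasurable_of_tendsto_ae atTop
    (f := fun N x => ∑ i ∈ Finset.range N, F i x) (fun N => ?_)
    (hf.mono fun x hx => hx.tendsto_sum_nat), ?_⟩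
  · exact (integrable_finsetSum _ fun i _ => hF i).1
  · refine lt_of_le_of_lt (lintegral_mono_ae ?_) (lintegral_tsum_enorm_ne_top hF hs).lt_top
    filter_upwards [hf] with x hx
    rw [← hx.tsum_eq]
    exact enorm_tsum_le_tsum_enorm

end Series

/-! ### Consequences of the Markov property -/

section Markov

variable {Z : Type*} [MeasurableSpace Z] {Ω : Type*} [mΩ : MeasurableSpace Ω]
  {P : Kernel Z Z} {ℱ : Filtration ℕ mΩ} {X : ℕ → Ω → Z} {Pr : Z → Measure Ω}

lemma IsMarkovFamily.measurable (hX : IsMarkovFamily P ℱ X Pr) (t : ℕ) : Measurable (X t) :=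
  (hX.adapted t).mono (ℱ.le t) le_rfl

/-- Singletons of `Z` need not be measurable, so the start at `z` is expressed through level sets of
measurable functions. -/
lemma IsMarkovFamily.ae_initial (hX : IsMarkovFamily P ℱ X Pr) (z : Z) {f : Z → ℝ}
    (hf : Measurable f) : ∀ᵐ ω ∂(Pr z), f (X 0 ω) = f z := by
  have hs : MeasurableSet {z' | f z' = f z} := hf (measurableSet_singleton _)
  have h : ∀ᵐ z' ∂((Pr z).map (X 0)), f z' = f z := by
    rw [hX.initial, ae_dirac_iff hs]
  exact ae_of_ae_map (hX.measurable 0).aemeasurable h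

lemma IsMarkovFamily.integrable_initial (hX : IsMarkovFamily P ℱ X Pr) (z : Z) {f : Z → ℝ}
    (hf : Measurable f) : Integrable (fun ω => f (X 0 ω)) (Pr z) := by
  have := hX.isProbabilityMeasure z
  exact (integrable_const (f z)).congr ((hX.ae_initial z hf).mono fun ω h => h.symm)

lemma IsMarkovFamily.integral_initial (hX : IsMarkovFamily P ℱ X Pr) (z : Z) {f : Z → ℝ}
    (hf : Measurable f) : ∫ ω, f (X 0 ω) ∂(Pr z) = f z := by
  have := hX.isProbabilityMeasure z
  rw [integral_congr_ae (hX.ae_initial z hf)]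
  simp

variable [IsMarkovKernel P]

/-- Integrating the conditional Markov property over an event `A` known at time `t` turns it into an
identity of measures, from which integrals of general functions follow. -/
lemma IsMarkovFamily.map_restrict_succ (hX : IsMarkovFamily P ℱ X Pr) (z : Z) (t : ℕ) {A : Set Ω}
    (hA : MeasurableSet[ℱ t] A) :
    ((Pr z).restrict A).map (X (t + 1)) = P ∘ₘ ((Pr z).restrict A).map (X t) := by
  have := hX.isProbabilityMeasure z
  have mX := hX.measurable
  ext B hB
  have hpre : MeasurableSet (X (t + 1) ⁻¹' B) := mX _ hB
  rw [Measure.bind_apply hB P.aemeasurable, lintegral_map (P.measurable_coe hB) (mX t),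
    Measure.map_apply (mX _) hB]
  have h1 : ∫ ω in A, (P (X t ω)).real B ∂(Pr z) = ((Pr z).restrict A).real (X (t + 1) ⁻¹' B) := by
    rw [← setIntegral_congr_ae (ℱ.le t _ hA) ((hX.markov z t B hB).mono fun ω h _ => h),
      setIntegral_condExp (ℱ.le t) ((integrable_const _).indicator hpre) hA,
      integral_indicator hpre]
    simp
  have h2 : ∫ ω in A, (P (X t ω)).real B ∂(Pr z)
      = (∫⁻ ω in A, P (X t ω) B ∂(Pr z)).toReal :=
    integral_toReal ((P.measurable_coe hB).comp (mX t)).aemeasurable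
      (Eventually.of_forall fun _ => measure_lt_top _ _)
  refine (ENNReal.toReal_eq_toReal_iff' (measure_ne_top _ _) ?_).1 (h1.symm.trans h2)
  refine ne_of_lt (lt_of_le_of_lt (lintegral_mono fun ω => prob_le_one) ?_)
  simp

lemma IsMarkovFamily.map_succ (hX : IsMarkovFamily P ℱ X Pr) (z : Z) (t : ℕ) :
    (Pr z).map (X (t + 1)) = P ∘ₘ (Pr z).map (X t) := by
  simpa using hX.map_restrict_succ z t (A := univ) MeasurableSet.univ

lemma integral_comp_measure {α γ : Type*} [MeasurableSpace α] [MeasurableSpace γ] {μ : Measure α}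
    {κ : Kernel α γ} {f : γ → ℝ} (hf : Integrable f (κ ∘ₘ μ)) :
    ∫ y, f y ∂(κ ∘ₘ μ) = ∫ x, ∫ y, f y ∂(κ x) ∂μ := by
  rw [Measure.comp_eq_comp_const_apply] at hf ⊢
  simpa using Kernel.integral_comp hf

lemma IsMarkovFamily.setIntegral_succ (hX : IsMarkovFamily P ℱ X Pr) (z : Z) (t : ℕ) {A : Set Ω}
    (hA : MeasurableSet[ℱ t] A) {f : Z → ℝ} (hf : Measurable f)
    (hi : Integrable (fun ω => f (X (t + 1) ω)) (Pr z)) :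
    ∫ ω in A, f (X (t + 1) ω) ∂(Pr z) = ∫ ω in A, ∫ z', f z' ∂(P (X t ω)) ∂(Pr z) := by
  have mX := hX.measurable
  have hi' : Integrable f (P ∘ₘ ((Pr z).restrict A).map (X t)) := by
    rw [← hX.map_restrict_succ z t hA]
    exact (integrable_map_measure hf.aestronglyMeasurable (mX _).aemeasurable).2 hi.integrableOn
  rw [← integral_map (mX _).aemeasurable hf.aestronglyMeasurable, hX.map_restrict_succ z t hA,
    integral_comp_measure hi', integral_map (mX _).aemeasurable
      hf.stronglyMeasurable.integral_kernel.aestronglyMeasurable]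

lemma IsMarkovFamily.integrable_succ (hX : IsMarkovFamily P ℱ X Pr) (z : Z) (t : ℕ)
    {f h : Z → ℝ} (hf : Measurable f) (hfi : ∀ z, Integrable f (P z)) {C : ℝ}
    (hfh : ∀ z, ∫ z', |f z'| ∂(P z) ≤ C * h z)
    (hh : Integrable (fun ω => h (X t ω)) (Pr z)) :
    Integrable (fun ω => f (X (t + 1) ω)) (Pr z) ∧
      ∫ ω, |f (X (t + 1) ω)| ∂(Pr z) ≤ C * ∫ ω, h (X t ω) ∂(Pr z) := by
  have mX := hX.measurable
  have mI : StronglyMeasurable fun x => ∫ y, |f y| ∂(P x) :=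
    hf.abs.stronglyMeasurable.integral_kernel
  have hI : Integrable (fun ω => ∫ y, |f y| ∂(P (X t ω))) (Pr z) := by
    refine (hh.const_mul C).mono' (mI.measurable.comp (mX t)).aestronglyMeasurable
      (Eventually.of_forall fun ω => ?_)
    rw [Real.norm_of_nonneg (integral_nonneg fun _ => abs_nonneg _)]
    exact hfh _
  have hint : Integrable (fun ω => f (X (t + 1) ω)) (Pr z) := by
    have : Integrable f ((Pr z).map (X (t + 1))) := by
      rw [hX.map_succ, Measure.integrable_comp_iff hf.aestronglyMeasurable]
      refine ⟨Eventually.of_forall hfi, ?_⟩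
      exact (integrable_map_measure mI.aestronglyMeasurable (mX t).aemeasurable).2 hI
    exact (integrable_map_measure hf.aestronglyMeasurable (mX _).aemeasurable).1 this
  refine ⟨hint, ?_⟩
  have h1 := hX.setIntegral_succ z t (A := univ) MeasurableSet.univ hf.abs hint.abs
  simp only [setIntegral_univ] at h1
  rw [h1, ← integral_const_mul]
  exact integral_mono hI (hh.const_mul C) fun ω => hfh _

/-! ### Discounted moments along the process -/

section Moments

variable {r c ℓ : Z → ℝ} {K a β : ℝ}

lemma WeightBounds.moment_weight (hW : WeightBounds P r c ℓ K a)
    (hX : IsMarkovFamily P ℱ X Pr) (z : Z) (t : ℕ) :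
    Integrable (fun ω => ℓ (X t ω)) (Pr z) ∧ ∫ ω, ℓ (X t ω) ∂(Pr z) ≤ a ^ t * ℓ z := by
  induction t with
  | zero =>
    refine ⟨hX.integrable_initial z hW.measurable, ?_⟩
    rw [hX.integral_initial z hW.measurable, pow_zero, one_mul]
  | succ t ih =>
    obtain ⟨h1, h2⟩ := hX.integrable_succ z t hW.measurable hW.integrable (C := a)
      (by simpa only [abs_of_pos (hW.pos _)] using hW.integral_le) ih.1
    refine ⟨h1, ?_⟩
    simp only [abs_of_pos (hW.pos _)] at h2
    calc _ ≤ _ := h2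
      _ ≤ a * (a ^ t * ℓ z) := mul_le_mul_of_nonneg_left ih.2 hW.a_nonneg
      _ = a ^ (t + 1) * ℓ z := by ring

lemma WeightBounds.discounted_moments (hW : WeightBounds P r c ℓ K a)
    (hX : IsMarkovFamily P ℱ X Pr) (hβ : 0 ≤ β) (hβa : β * a < 1)
    {f : Z → ℝ} (hf : Measurable f) (hfi : ∀ z, Integrable f (P z)) {C : ℝ} (hC : 0 ≤ C)
    (hfℓ : ∀ z, ∫ z', |f z'| ∂(P z) ≤ C * ℓ z) (z : Z) :
    (∀ t, Integrable (fun ω => f (X t ω)) (Pr z)) ∧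
      Summable fun t => β ^ t * ∫ ω, |f (X t ω)| ∂(Pr z) := by
  have key := fun t => hX.integrable_succ z t hf hfi hfℓ (hW.moment_weight hX z t).1
  -- The hypothesis bounds `|f|` only after a transition, so time `0` is split off and handled by
  -- the initial law.
  refine ⟨fun t => ?_, (summable_nat_add_iff 1).1 ?_⟩
  · cases t with
    | zero => exact hX.integrable_initial z hf
    | succ t => exact (key t).1
  · have hρ : 0 ≤ β * a := mul_nonneg hβ hW.a_nonneg
    refine Summable.of_nonneg_of_le
      (fun t => mul_nonneg (pow_nonneg hβ _) (integral_nonneg fun _ => abs_nonneg _)) (fun t => ?_)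
      ((summable_geometric_of_lt_one hρ hβa).mul_left (β * C * ℓ z))
    calc β ^ (t + 1) * ∫ ω, |f (X (t + 1) ω)| ∂(Pr z)
        ≤ β ^ (t + 1) * (C * (a ^ t * ℓ z)) :=
          mul_le_mul_of_nonneg_left ((key t).2.trans
            (mul_le_mul_of_nonneg_left (hW.moment_weight hX z t).2 hC)) (pow_nonneg hβ _)
      _ = β * C * ℓ z * (β * a) ^ t := by ring

end Moments

end Markov

/-! ### Decomposition of the payoff into stages -/

section Stage

variable {Z : Type*} {Ω : Type*} {β : ℝ} {r c : Z → ℝ} {X : ℕ → Ω → Z} {τ : Ω → WithTop ℕ}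

/-- The part of the payoff of `τ` that accrues at time `t`. -/
noncomputable def stagePayoff (β : ℝ) (r c : Z → ℝ) (X : ℕ → Ω → Z) (τ : Ω → WithTop ℕ) (t : ℕ)
    (ω : Ω) : ℝ :=
  {ω | (t : WithTop ℕ) < τ ω}.indicator (fun ω => β ^ t * c (X t ω)) ω +
    {ω | τ ω = t}.indicator (fun ω => β ^ t * r (X t ω)) ω

lemma payoff_of_eq_coe {ω : Ω} {k : ℕ} (h : τ ω = k) :
    payoff β r c X τ ω = ∑ t ∈ Finset.range k, β ^ t * c (X t ω) + β ^ k * r (X k ω) := by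
  rw [payoff, h]; rfl

lemma payoff_of_eq_top {ω : Ω} (h : τ ω = ⊤) :
    payoff β r c X τ ω = ∑' t : ℕ, β ^ t * c (X t ω) := by
  rw [payoff, h]; rfl

lemma stagePayoff_of_lt {ω : Ω} {t : ℕ} (h : (t : WithTop ℕ) < τ ω) :
    stagePayoff β r c X τ t ω = β ^ t * c (X t ω) := by
  simp [stagePayoff, indicator, h, h.ne']

lemma stagePayoff_of_eq {ω : Ω} {t : ℕ} (h : τ ω = t) :
    stagePayoff β r c X τ t ω = β ^ t * r (X t ω) := by
  simp [stagePayoff, indicator, h]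

lemma stagePayoff_of_gt {ω : Ω} {t : ℕ} (h : τ ω < (t : WithTop ℕ)) :
    stagePayoff β r c X τ t ω = 0 := by
  simp [stagePayoff, indicator, h.ne, h.not_gt]

lemma hasSum_stagePayoff {ω : Ω} (hs : Summable fun t : ℕ => β ^ t * c (X t ω)) :
    HasSum (fun t => stagePayoff β r c X τ t ω) (payoff β r c X τ ω) := by
  rcases h : τ ω with _ | k
  · have h' : τ ω = ⊤ := h
    rw [payoff_of_eq_top h']
    have e : (fun t => stagePayoff β r c X τ t ω) = fun t : ℕ => β ^ t * c (X t ω) :=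
      funext fun t => stagePayoff_of_lt (by rw [h']; exact WithTop.coe_lt_top t)
    rw [e]
    exact hs.hasSum
  · have h' : τ ω = k := h
    have e : payoff β r c X τ ω = ∑ t ∈ Finset.range (k + 1), stagePayoff β r c X τ t ω := by
      rw [payoff_of_eq_coe h', Finset.sum_range_succ, stagePayoff_of_eq h']
      congr 1
      refine Finset.sum_congr rfl fun t ht => (stagePayoff_of_lt ?_).symm
      rw [h']
      exact_mod_cast Finset.mem_range.1 ht
    rw [e]
    refine hasSum_sum_of_ne_finset_zero fun t ht => stagePayoff_of_gt ?_
    rw [h']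
    rw [Finset.mem_range, not_lt] at ht
    exact_mod_cast ht

/-- On `τ = N` the exit payoff is counted by the indicator, since the sum ends at stage `N - 1`. -/
lemma payoff_min_const (N : ℕ) (ω : Ω) :
    payoff β r c X (fun ω => min (τ ω) N) ω =
      ∑ t ∈ Finset.range N, stagePayoff β r c X τ t ω +
        {ω | (N : WithTop ℕ) ≤ τ ω}.indicator (fun ω => β ^ N * r (X N ω)) ω := by
  rcases le_or_gt (N : WithTop ℕ) (τ ω) with h | h
  · rw [payoff_of_eq_coe (τ := fun ω => min (τ ω) N) (k := N) (min_eq_right h),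
      indicator_of_mem (by exact h)]
    congr 1
    refine Finset.sum_congr rfl fun t ht => (stagePayoff_of_lt (lt_of_lt_of_le ?_ h)).symm
    exact_mod_cast Finset.mem_range.1 ht
  · obtain ⟨k, hk⟩ := WithTop.ne_top_iff_exists.1 h.ne_top
    have hkN : k < N := WithTop.coe_lt_coe.1 (hk.trans_lt h)
    rw [payoff_of_eq_coe (τ := fun ω => min (τ ω) N) (k := k) ((min_eq_left h.le).trans hk.symm),
      indicator_of_notMem (by simpa using h), add_zero,
      ← Finset.sum_subset (Finset.range_subset_range.2 (Nat.succ_le_of_lt hkN)),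
      Finset.sum_range_succ, stagePayoff_of_eq hk.symm]
    · congr 1
      refine Finset.sum_congr rfl fun t ht => (stagePayoff_of_lt ?_).symm
      rw [← hk]
      exact WithTop.coe_lt_coe.2 (Finset.mem_range.1 ht)
    · intro t _ ht
      refine stagePayoff_of_gt ?_
      rw [← hk]
      rw [Finset.mem_range, not_lt] at ht
      exact WithTop.coe_lt_coe.2 ht

lemma policyTime_threshold_le {ψ : Z → ℝ} {ω : Ω} {t : ℕ}
    (h : (t : WithTop ℕ) < policyTime X (thresholdPolicy r ψ) ω) : r (X t ω) ≤ ψ (X t ω) := by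
  have := notMem_of_lt_hittingAfter h (Nat.zero_le t)
  by_contra hlt
  exact this (by simp [thresholdPolicy, (not_le.1 hlt).le])

lemma le_of_policyTime_threshold_eq {ψ : Z → ℝ} {ω : Ω} {t : ℕ}
    (h : policyTime X (thresholdPolicy r ψ) ω = t) : ψ (X t ω) ≤ r (X t ω) := by
  have h1 := hittingAfter_mem_set_of_ne_top (u := X) (s := {z | thresholdPolicy r ψ z = 1}) (n := 0)
    (ω := ω) (by rw [policyTime] at h; rw [h]; exact WithTop.coe_ne_top)
  rw [policyTime] at h
  rw [h, show (t : WithTop ℕ).untopA = t from rfl] at h1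
  simpa [thresholdPolicy] using h1

end Stage

/-! ### Verification of the fixed point -/

section Verification

variable {Z : Type*} [MeasurableSpace Z] {Ω : Type*} [mΩ : MeasurableSpace Ω]
  {P : Kernel Z Z} {ℱ : Filtration ℕ mΩ} {X : ℕ → Ω → Z} {Pr : Z → Measure Ω}
  {r c ℓ : Z → ℝ} {K a β : ℝ} {τ : Ω → WithTop ℕ}

lemma _root_.MeasureTheory.IsStoppingTime.measurableSet_eq_nat (hτ : IsStoppingTime ℱ τ) (t : ℕ) :
    MeasurableSet[ℱ t] {ω | τ ω = (t : WithTop ℕ)} :=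
  hτ.measurableSet_eq t

lemma _root_.MeasureTheory.IsStoppingTime.measurableSet_gt_nat (hτ : IsStoppingTime ℱ τ) (t : ℕ) :
    MeasurableSet[ℱ t] {ω | (t : WithTop ℕ) < τ ω} := by
  have : {ω | (t : WithTop ℕ) < τ ω} = {ω | τ ω ≤ t}ᶜ := by ext; simp
  rw [this]
  exact (hτ t).compl

lemma min_const_mem_finiteStoppingTimes {S : Type*} {Pr : S → Measure Ω}
    (hτ : IsStoppingTime ℱ τ) (N : ℕ) :
    (fun ω => min (τ ω) N) ∈ finiteStoppingTimes ℱ Pr :=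
  ⟨hτ.min_const N, fun _ => Eventually.of_forall fun _ =>
    ((min_le_right _ _).trans_lt (WithTop.coe_lt_top N)).ne⟩

lemma isStoppingTime_policyTime_threshold (hX : IsMarkovFamily P ℱ X Pr) {ψ : Z → ℝ}
    (hr : Measurable r) (hψ : Measurable ψ) :
    IsStoppingTime ℱ (policyTime X (thresholdPolicy r ψ)) := by
  refine Adapted.isStoppingTime_hittingAfter (fun t => hX.adapted t) ?_
  have : {z | thresholdPolicy r ψ z = 1} = {z | ψ z ≤ r z} := by
    ext z
    by_cases h : ψ z ≤ r z <;> simp [thresholdPolicy, h]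
  rw [this]
  exact measurableSet_le hψ hr

/-- The expected discounted value `max r ψ` carried into stage `t` by a rule that has not
stopped before. -/
noncomputable def carriedValue (β : ℝ) (r ψ : Z → ℝ) (X : ℕ → Ω → Z)
    (Pr : Z → Measure Ω) (τ : Ω → WithTop ℕ) (z : Z) (t : ℕ) : ℝ :=
  ∫ ω in {ω | (t : WithTop ℕ) ≤ τ ω}, β ^ t * max (r (X t ω)) (ψ (X t ω)) ∂(Pr z)

lemma carriedValue_zero (hX : IsMarkovFamily P ℱ X Pr) (hr : Measurable r) {ψ : Z → ℝ}
    (hψ : Measurable ψ) (z : Z) : carriedValue β r ψ X Pr τ z 0 = max (r z) (ψ z) := by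
  have : {ω | ((0 : ℕ) : WithTop ℕ) ≤ τ ω} = univ := by ext; simp
  rw [carriedValue, this, setIntegral_univ]
  simp only [pow_zero, one_mul]
  exact hX.integral_initial z (hr.max hψ)

variable [IsMarkovKernel P]

/-! ### Integrability, telescoping and optimality -/

namespace WeightBounds

lemma exit_moments (hW : WeightBounds P r c ℓ K a) (hX : IsMarkovFamily P ℱ X Pr) (hβ : 0 ≤ β)
    (hβa : β * a < 1) (z : Z) :
    (∀ t, Integrable (fun ω => r (X t ω)) (Pr z)) ∧
      Summable fun t => β ^ t * ∫ ω, |r (X t ω)| ∂(Pr z) :=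
  hW.discounted_moments hX hβ hβa hW.measurable_exit hW.integrable_exit hW.K_nonneg
    hW.integral_exit_le z

lemma flow_moments (hW : WeightBounds P r c ℓ K a) (hX : IsMarkovFamily P ℱ X Pr) (hβ : 0 ≤ β)
    (hβa : β * a < 1) (z : Z) :
    (∀ t, Integrable (fun ω => c (X t ω)) (Pr z)) ∧
      Summable fun t => β ^ t * ∫ ω, |c (X t ω)| ∂(Pr z) := by
  have hci := hW.integrable_of_abs_le hW.measurable_flow hW.flow_le
  refine hW.discounted_moments hX hβ hβa hW.measurable_flow hci
    (mul_nonneg hW.K_nonneg hW.a_nonneg) (fun z => ?_) z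
  calc ∫ z', |c z'| ∂(P z) ≤ ∫ z', K * ℓ z' ∂(P z) :=
        integral_mono (hci z).abs ((hW.integrable z).const_mul K) hW.flow_le
    _ ≤ K * (a * ℓ z) := by
        rw [integral_const_mul]
        exact mul_le_mul_of_nonneg_left (hW.integral_le z) hW.K_nonneg
    _ = K * a * ℓ z := by ring

lemma max_moments (hW : WeightBounds P r c ℓ K a) (hX : IsMarkovFamily P ℱ X Pr) (hβ : 0 ≤ β)
    (hβa : β * a < 1) {f : Z → ℝ} (hf : f ∈ weightedBounded ℓ) (z : Z) :
    (∀ t, Integrable (fun ω => max (r (X t ω)) (f (X t ω))) (Pr z)) ∧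
      Summable fun t => β ^ t * ∫ ω, |max (r (X t ω)) (f (X t ω))| ∂(Pr z) := by
  obtain ⟨mf, C, hC, bC⟩ := (mem_weightedBounded_iff hW.pos).1 hf
  exact hW.discounted_moments hX hβ hβa (hW.measurable_exit.max mf) (hW.integrable_max hf)
    (add_nonneg hW.K_nonneg (mul_nonneg hC hW.a_nonneg)) (hW.integral_abs_max_le mf hC bC) z

lemma ae_summable_flow (hW : WeightBounds P r c ℓ K a) (hX : IsMarkovFamily P ℱ X Pr) (hβ : 0 ≤ β)
    (hβa : β * a < 1) (z : Z) : ∀ᵐ ω ∂(Pr z), Summable fun t : ℕ => β ^ t * c (X t ω) := by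
  obtain ⟨h1, h2⟩ := hW.flow_moments hX hβ hβa z
  refine (ae_summable_abs_of_summable_integral (F := fun t ω => β ^ t * c (X t ω))
    (fun t => (h1 t).const_mul _) ?_).mono fun ω h => h.of_abs
  simpa only [abs_mul, abs_of_nonneg (pow_nonneg hβ _), integral_const_mul] using h2

lemma stagePayoff_moments (hW : WeightBounds P r c ℓ K a) (hX : IsMarkovFamily P ℱ X Pr)
    (hβ : 0 ≤ β) (hβa : β * a < 1) (hτ : IsStoppingTime ℱ τ) (z : Z) :
    (∀ t, Integrable (stagePayoff β r c X τ t) (Pr z)) ∧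
      Summable fun t => ∫ ω, |stagePayoff β r c X τ t ω| ∂(Pr z) := by
  obtain ⟨r1, r2⟩ := hW.exit_moments hX hβ hβa z
  obtain ⟨c1, c2⟩ := hW.flow_moments hX hβ hβa z
  have hi : ∀ t, Integrable (stagePayoff β r c X τ t) (Pr z) := fun t =>
    (((c1 t).const_mul _).indicator (ℱ.le t _ (hτ.measurableSet_gt_nat t))).add
      (((r1 t).const_mul _).indicator (ℱ.le t _ (hτ.measurableSet_eq_nat t)))
  refine ⟨hi, Summable.of_nonneg_of_le (fun t => integral_nonneg fun _ => abs_nonneg _)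
    (fun t => ?_) (c2.add r2)⟩
  rw [← integral_const_mul, ← integral_const_mul,
    ← integral_add ((c1 t).abs.const_mul _) ((r1 t).abs.const_mul _)]
  refine integral_mono (hi t).abs (((c1 t).abs.const_mul _).add ((r1 t).abs.const_mul _))
    fun ω => (abs_add_le _ _).trans (add_le_add ?_ ?_)
  · refine (norm_indicator_le_norm_self (fun ω => β ^ t * c (X t ω)) ω).trans ?_
    rw [Real.norm_eq_abs, abs_mul, abs_of_nonneg (pow_nonneg hβ t)]
  · refine (norm_indicator_le_norm_self (fun ω => β ^ t * r (X t ω)) ω).trans ?_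
    rw [Real.norm_eq_abs, abs_mul, abs_of_nonneg (pow_nonneg hβ t)]

lemma integrable_payoff (hW : WeightBounds P r c ℓ K a) (hX : IsMarkovFamily P ℱ X Pr)
    (hβ : 0 ≤ β) (hβa : β * a < 1) (hτ : IsStoppingTime ℱ τ) (z : Z) :
    Integrable (payoff β r c X τ) (Pr z) := by
  obtain ⟨h1, h2⟩ := hW.stagePayoff_moments hX hβ hβa hτ z
  exact integrable_of_hasSum h1 h2
    ((hW.ae_summable_flow hX hβ hβa z).mono fun ω h => hasSum_stagePayoff h)

lemma hasSum_integral_stagePayoff (hW : WeightBounds P r c ℓ K a) (hX : IsMarkovFamily P ℱ X Pr)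
    (hβ : 0 ≤ β) (hβa : β * a < 1) (hτ : IsStoppingTime ℱ τ) (z : Z) :
    HasSum (fun t => ∫ ω, stagePayoff β r c X τ t ω ∂(Pr z))
      (∫ ω, payoff β r c X τ ω ∂(Pr z)) := by
  obtain ⟨h1, h2⟩ := hW.stagePayoff_moments hX hβ hβa hτ z
  rw [integral_congr_ae ((hW.ae_summable_flow hX hβ hβa z).mono fun ω h =>
    (hasSum_stagePayoff (r := r) (τ := τ) h).tsum_eq.symm)]
  exact hasSum_integral_of_summable_integral_norm h1 h2

/-- Transversality: the carried value is dominated by the terms of a convergent series. -/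
lemma tendsto_carriedValue (hW : WeightBounds P r c ℓ K a) (hX : IsMarkovFamily P ℱ X Pr)
    (hβ : 0 ≤ β) (hβa : β * a < 1) {ψ : Z → ℝ} (hψ : ψ ∈ weightedBounded ℓ)
    (z : Z) : Tendsto (carriedValue β r ψ X Pr τ z) atTop (𝓝 0) := by
  obtain ⟨h1, h2⟩ := hW.max_moments hX hβ hβa hψ z
  refine squeeze_zero_norm (fun t => ?_) h2.tendsto_atTop_zero
  calc ‖carriedValue β r ψ X Pr τ z t‖
      ≤ ∫ ω in {ω | (t : WithTop ℕ) ≤ τ ω}, |β ^ t * max (r (X t ω)) (ψ (X t ω))| ∂(Pr z) :=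
        abs_integral_le_integral_abs
    _ ≤ ∫ ω, |β ^ t * max (r (X t ω)) (ψ (X t ω))| ∂(Pr z) :=
        setIntegral_le_integral ((h1 t).const_mul _).abs (Eventually.of_forall fun _ => abs_nonneg _)
    _ = _ := by simp only [abs_mul, abs_of_nonneg (pow_nonneg hβ _), integral_const_mul]

lemma integrable_of_mem_comp (hW : WeightBounds P r c ℓ K a) (hX : IsMarkovFamily P ℱ X Pr)
    {f : Z → ℝ} (hf : f ∈ weightedBounded ℓ) (z : Z) (t : ℕ) :
    Integrable (fun ω => f (X t ω)) (Pr z) := by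
  obtain ⟨mf, C, -, bC⟩ := (mem_weightedBounded_iff hW.pos).1 hf
  exact ((hW.moment_weight hX z t).1.const_mul C).mono'
    (mf.comp (hX.measurable t)).aestronglyMeasurable (Eventually.of_forall fun ω => bC _)

/-- Surviving into stage `t + 1` is the event `{t < τ}`, which is known at time `t`. There the
Markov property replaces the next carried value by `β P w`, and flow plus `β P w` is `ψ` by the
fixed-point equation. -/
lemma integral_stagePayoff_add_carriedValue (hW : WeightBounds P r c ℓ K a)
    (hX : IsMarkovFamily P ℱ X Pr) (hβ : 0 ≤ β) (hβa : β * a < 1) {ψ : Z → ℝ}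
    (hψ : ψ ∈ weightedBounded ℓ) (hQ : jovanovic P β r c ψ = ψ) (hτ : IsStoppingTime ℱ τ)
    (z : Z) (t : ℕ) :
    ∫ ω, stagePayoff β r c X τ t ω ∂(Pr z) + carriedValue β r ψ X Pr τ z (t + 1) =
      ∫ ω in {ω | (t : WithTop ℕ) < τ ω}, β ^ t * ψ (X t ω) ∂(Pr z) +
        ∫ ω in {ω | τ ω = t}, β ^ t * r (X t ω) ∂(Pr z) := by
  obtain ⟨r1, -⟩ := hW.exit_moments hX hβ hβa z
  obtain ⟨c1, -⟩ := hW.flow_moments hX hβ hβa z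
  obtain ⟨w1, -⟩ := hW.max_moments hX hβ hβa hψ z
  have mw : Measurable fun z => max (r z) (ψ z) := hW.measurable_exit.max hψ.1
  have hgt := hτ.measurableSet_gt_nat t
  have hgt' := ℱ.le t _ hgt
  have heq' := ℱ.le t _ (hτ.measurableSet_eq_nat t)
  have hset : {ω | ((t + 1 : ℕ) : WithTop ℕ) ≤ τ ω} = {ω | (t : WithTop ℕ) < τ ω} := by
    ext ω
    rw [mem_ofPred_eq, mem_ofPred_eq]
    generalize τ ω = s
    induction s using WithTop.recTopCoe with
    | top => exact iff_of_true le_top (WithTop.coe_lt_top t)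
    | coe k => exact WithTop.coe_le_coe.trans (Nat.succ_le_iff.trans WithTop.coe_lt_coe.symm)
  have hstage : ∫ ω, stagePayoff β r c X τ t ω ∂(Pr z) =
      ∫ ω in {ω | (t : WithTop ℕ) < τ ω}, β ^ t * c (X t ω) ∂(Pr z) +
        ∫ ω in {ω | τ ω = t}, β ^ t * r (X t ω) ∂(Pr z) := by
    simp only [stagePayoff]
    rw [integral_add (((c1 t).const_mul (β ^ t)).indicator hgt')
      (((r1 t).const_mul (β ^ t)).indicator heq'),
      integral_indicator hgt', integral_indicator heq']
  have hψeq : ∀ ω, β ^ t * ψ (X t ω) = β ^ t * c (X t ω) +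
      β ^ (t + 1) * ∫ z', max (r z') (ψ z') ∂(P (X t ω)) := fun ω => by
    conv_lhs => rw [← hQ, jovanovic]
    ring
  -- Integrability comes from the fixed-point equation, which makes this term a difference of
  -- integrable ones.
  have hPw : Integrable (fun ω => β ^ (t + 1) * ∫ z', max (r z') (ψ z') ∂(P (X t ω))) (Pr z) := by
    refine (((hW.integrable_of_mem_comp hX hψ z t).const_mul (β ^ t)).sub
      ((c1 t).const_mul (β ^ t))).congr
      (Eventually.of_forall fun ω => ?_)
    simp [hψeq ω]
  rw [hstage, carriedValue, hset, integral_const_mul (β ^ (t + 1)),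
    hX.setIntegral_succ z t hgt mw (w1 (t + 1)), ← integral_const_mul (β ^ (t + 1))]
  simp_rw [hψeq]
  rw [integral_add ((c1 t).const_mul (β ^ t)).integrableOn hPw.integrableOn]
  ring

lemma carriedValue_eq_add (hW : WeightBounds P r c ℓ K a)
    (hX : IsMarkovFamily P ℱ X Pr) (hβ : 0 ≤ β) (hβa : β * a < 1) {ψ : Z → ℝ}
    (hψ : ψ ∈ weightedBounded ℓ) (hτ : IsStoppingTime ℱ τ) (z : Z) (t : ℕ) :
    carriedValue β r ψ X Pr τ z t =
      ∫ ω in {ω | (t : WithTop ℕ) < τ ω}, β ^ t * max (r (X t ω)) (ψ (X t ω)) ∂(Pr z) +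
        ∫ ω in {ω | τ ω = t}, β ^ t * max (r (X t ω)) (ψ (X t ω)) ∂(Pr z) := by
  obtain ⟨w1, -⟩ := hW.max_moments hX hβ hβa hψ z
  have heq' := ℱ.le t _ (hτ.measurableSet_eq_nat t)
  have hset : {ω | (t : WithTop ℕ) ≤ τ ω} = {ω | (t : WithTop ℕ) < τ ω} ∪ {ω | τ ω = t} := by
    ext ω
    simp only [mem_ofPred_eq, mem_union, le_iff_lt_or_eq, eq_comm]
  rw [carriedValue, hset, setIntegral_union ?_ heq' ((w1 t).const_mul (β ^ t)).integrableOn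
    ((w1 t).const_mul (β ^ t)).integrableOn]
  rw [Set.disjoint_left]
  intro ω h1 h2
  exact h1.ne' h2

/-- Supermartingale inequality: `ψ ≤ max r ψ` where the rule continues, `r ≤ max r ψ` where it
stops. -/
lemma integral_stagePayoff_le (hW : WeightBounds P r c ℓ K a)
    (hX : IsMarkovFamily P ℱ X Pr) (hβ : 0 ≤ β) (hβa : β * a < 1) {ψ : Z → ℝ}
    (hψ : ψ ∈ weightedBounded ℓ) (hQ : jovanovic P β r c ψ = ψ) (hτ : IsStoppingTime ℱ τ)
    (z : Z) (t : ℕ) :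
    ∫ ω, stagePayoff β r c X τ t ω ∂(Pr z) ≤
      carriedValue β r ψ X Pr τ z t - carriedValue β r ψ X Pr τ z (t + 1) := by
  obtain ⟨r1, -⟩ := hW.exit_moments hX hβ hβa z
  obtain ⟨w1, -⟩ := hW.max_moments hX hβ hβa hψ z
  rw [le_sub_iff_add_le, hW.integral_stagePayoff_add_carriedValue hX hβ hβa hψ hQ hτ,
    hW.carriedValue_eq_add hX hβ hβa hψ hτ]
  have hβt := pow_nonneg hβ t
  refine add_le_add
    (integral_mono ((hW.integrable_of_mem_comp hX hψ z t).const_mul _).integrableOn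
      ((w1 t).const_mul _).integrableOn fun ω => ?_)
    (integral_mono ((r1 t).const_mul _).integrableOn ((w1 t).const_mul _).integrableOn fun ω => ?_)
  · exact mul_le_mul_of_nonneg_left (le_max_right _ _) hβt
  · exact mul_le_mul_of_nonneg_left (le_max_left _ _) hβt

lemma integral_stagePayoff_eq (hW : WeightBounds P r c ℓ K a)
    (hX : IsMarkovFamily P ℱ X Pr) (hβ : 0 ≤ β) (hβa : β * a < 1) {ψ : Z → ℝ}
    (hψ : ψ ∈ weightedBounded ℓ) (hQ : jovanovic P β r c ψ = ψ) (hτ : IsStoppingTime ℱ τ)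
    (hcont : ∀ ω, ∀ t : ℕ, (t : WithTop ℕ) < τ ω → r (X t ω) ≤ ψ (X t ω))
    (hhalt : ∀ ω, ∀ t : ℕ, τ ω = t → ψ (X t ω) ≤ r (X t ω)) (z : Z) (t : ℕ) :
    ∫ ω, stagePayoff β r c X τ t ω ∂(Pr z) =
      carriedValue β r ψ X Pr τ z t - carriedValue β r ψ X Pr τ z (t + 1) := by
  rw [eq_sub_iff_add_eq, hW.integral_stagePayoff_add_carriedValue hX hβ hβa hψ hQ hτ,
    hW.carriedValue_eq_add hX hβ hβa hψ hτ]
  congr 1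
  · refine setIntegral_congr_fun (ℱ.le t _ (hτ.measurableSet_gt_nat t)) fun ω h => ?_
    simp only [max_eq_right (hcont ω t h)]
  · refine setIntegral_congr_fun (ℱ.le t _ (hτ.measurableSet_eq_nat t)) fun ω h => ?_
    simp only [max_eq_left (hhalt ω t h)]

theorem integral_payoff_le (hW : WeightBounds P r c ℓ K a)
    (hX : IsMarkovFamily P ℱ X Pr) (hβ : 0 ≤ β) (hβa : β * a < 1) {ψ : Z → ℝ}
    (hψ : ψ ∈ weightedBounded ℓ) (hQ : jovanovic P β r c ψ = ψ) (hτ : IsStoppingTime ℱ τ)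
    (z : Z) : ∫ ω, payoff β r c X τ ω ∂(Pr z) ≤ max (r z) (ψ z) := by
  have h1 := (hW.hasSum_integral_stagePayoff hX hβ hβa hτ z).tendsto_sum_nat
  have h2 := (hW.tendsto_carriedValue (τ := τ) hX hβ hβa hψ z).const_sub
    (carriedValue β r ψ X Pr τ z 0)
  rw [carriedValue_zero hX hW.measurable_exit hψ.1, sub_zero] at h2
  refine le_of_tendsto_of_tendsto' h1 h2 fun N => ?_
  rw [← carriedValue_zero (β := β) (τ := τ) hX hW.measurable_exit hψ.1 z, ← Finset.sum_range_sub']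
  exact Finset.sum_le_sum fun t _ => hW.integral_stagePayoff_le hX hβ hβa hψ hQ hτ z t

theorem integral_payoff_eq (hW : WeightBounds P r c ℓ K a)
    (hX : IsMarkovFamily P ℱ X Pr) (hβ : 0 ≤ β) (hβa : β * a < 1) {ψ : Z → ℝ}
    (hψ : ψ ∈ weightedBounded ℓ) (hQ : jovanovic P β r c ψ = ψ) (hτ : IsStoppingTime ℱ τ)
    (hcont : ∀ ω, ∀ t : ℕ, (t : WithTop ℕ) < τ ω → r (X t ω) ≤ ψ (X t ω))
    (hhalt : ∀ ω, ∀ t : ℕ, τ ω = t → ψ (X t ω) ≤ r (X t ω)) (z : Z) :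
    ∫ ω, payoff β r c X τ ω ∂(Pr z) = max (r z) (ψ z) := by
  have h1 := (hW.hasSum_integral_stagePayoff hX hβ hβa hτ z).tendsto_sum_nat
  have h2 := (hW.tendsto_carriedValue (τ := τ) hX hβ hβa hψ z).const_sub
    (carriedValue β r ψ X Pr τ z 0)
  rw [carriedValue_zero hX hW.measurable_exit hψ.1, sub_zero] at h2
  refine tendsto_nhds_unique h1 (h2.congr fun N => ?_)
  rw [← carriedValue_zero (β := β) (τ := τ) hX hW.measurable_exit hψ.1 z, ← Finset.sum_range_sub']
  exact (Finset.sum_congr rfl fun t _ =>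
    hW.integral_stagePayoff_eq hX hβ hβa hψ hQ hτ hcont hhalt z t).symm

/-- The truncations of a stopping time have expected payoffs that converge to its own. -/
theorem tendsto_integral_payoff_min (hW : WeightBounds P r c ℓ K a)
    (hX : IsMarkovFamily P ℱ X Pr) (hβ : 0 ≤ β) (hβa : β * a < 1) (hτ : IsStoppingTime ℱ τ)
    (z : Z) :
    Tendsto (fun N : ℕ => ∫ ω, payoff β r c X (fun ω => min (τ ω) N) ω ∂(Pr z)) atTop
      (𝓝 (∫ ω, payoff β r c X τ ω ∂(Pr z))) := by
  obtain ⟨r1, r2⟩ := hW.exit_moments hX hβ hβa z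
  obtain ⟨s1, -⟩ := hW.stagePayoff_moments hX hβ hβa hτ z
  have mge : ∀ N : ℕ, MeasurableSet {ω | (N : WithTop ℕ) ≤ τ ω} := fun N =>
    ℱ.le N _ (hτ.measurableSet_ge N)
  have e : ∀ N : ℕ, ∫ ω, payoff β r c X (fun ω => min (τ ω) N) ω ∂(Pr z) =
      ∑ t ∈ Finset.range N, ∫ ω, stagePayoff β r c X τ t ω ∂(Pr z) +
        ∫ ω in {ω | (N : WithTop ℕ) ≤ τ ω}, β ^ N * r (X N ω) ∂(Pr z) := fun N => by
    simp_rw [payoff_min_const]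
    rw [integral_add (integrable_finsetSum _ fun t _ => s1 t)
      (((r1 N).const_mul _).indicator (mge N)), integral_indicator (mge N),
      integral_finsetSum _ fun t _ => s1 t]
  have h0 : Tendsto (fun N : ℕ => ∫ ω in {ω | (N : WithTop ℕ) ≤ τ ω}, β ^ N * r (X N ω) ∂(Pr z))
      atTop (𝓝 0) := by
    refine squeeze_zero_norm (fun N => ?_) r2.tendsto_atTop_zero
    calc _ ≤ ∫ ω in {ω | (N : WithTop ℕ) ≤ τ ω}, |β ^ N * r (X N ω)| ∂(Pr z) :=
          abs_integral_le_integral_abs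
      _ ≤ ∫ ω, |β ^ N * r (X N ω)| ∂(Pr z) :=
          setIntegral_le_integral ((r1 N).const_mul _).abs
            (Eventually.of_forall fun _ => abs_nonneg _)
      _ = _ := by simp only [abs_mul, abs_of_nonneg (pow_nonneg hβ _), integral_const_mul]
  simp_rw [e]
  simpa using (hW.hasSum_integral_stagePayoff hX hβ hβa hτ z).tendsto_sum_nat.add h0

theorem integral_payoff_policyTime (hW : WeightBounds P r c ℓ K a)
    (hX : IsMarkovFamily P ℱ X Pr) (hβ : 0 ≤ β) (hβa : β * a < 1) {ψ : Z → ℝ}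
    (hψ : ψ ∈ weightedBounded ℓ) (hQ : jovanovic P β r c ψ = ψ) (z : Z) :
    ∫ ω, payoff β r c X (policyTime X (thresholdPolicy r ψ)) ω ∂(Pr z) = max (r z) (ψ z) :=
  hW.integral_payoff_eq hX hβ hβa hψ hQ
    (isStoppingTime_policyTime_threshold hX hW.measurable_exit hψ.1)
    (fun _ _ => policyTime_threshold_le) (fun _ _ => le_of_policyTime_threshold_eq) z

/-- The threshold rule need not be finite, so an upper bound is tested on its truncations and passed
to the limit. -/
theorem isLUB_attainableValues (hW : WeightBounds P r c ℓ K a)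
    (hX : IsMarkovFamily P ℱ X Pr) (hβ : 0 ≤ β) (hβa : β * a < 1) {ψ : Z → ℝ}
    (hψ : ψ ∈ weightedBounded ℓ) (hQ : jovanovic P β r c ψ = ψ) (z : Z) :
    IsLUB (attainableValues β r c ℱ X Pr z) (max (r z) (ψ z)) := by
  have hτ := isStoppingTime_policyTime_threshold hX hW.measurable_exit hψ.1
  refine ⟨?_, fun u hu => ?_⟩
  · rintro _ ⟨τ, hτ, rfl⟩
    exact hW.integral_payoff_le hX hβ hβa hψ hQ hτ.1 z
  · rw [← hW.integral_payoff_policyTime hX hβ hβa hψ hQ z]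
    exact le_of_tendsto' (hW.tendsto_integral_payoff_min hX hβ hβa hτ z) fun N =>
      hu ⟨_, min_const_mem_finiteStoppingTimes hτ N, rfl⟩

theorem valueFn_eq (hW : WeightBounds P r c ℓ K a)
    (hX : IsMarkovFamily P ℱ X Pr) (hβ : 0 ≤ β) (hβa : β * a < 1) {ψ : Z → ℝ}
    (hψ : ψ ∈ weightedBounded ℓ) (hQ : jovanovic P β r c ψ = ψ) :
    valueFn β r c ℱ X Pr = fun z => max (r z) (ψ z) :=
  funext fun z => (hW.isLUB_attainableValues hX hβ hβa hψ hQ z).csSup_eq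
    -- Stopping at once is a finite rule, so the set is nonempty and `sSup` is the true supremum.
    ⟨_, _, min_const_mem_finiteStoppingTimes (isStoppingTime_const ℱ 0) 0, rfl⟩

theorem continuationValue_eq (hW : WeightBounds P r c ℓ K a)
    (hX : IsMarkovFamily P ℱ X Pr) (hβ : 0 ≤ β) (hβa : β * a < 1) {ψ : Z → ℝ}
    (hψ : ψ ∈ weightedBounded ℓ) (hQ : jovanovic P β r c ψ = ψ) :
    continuationValue P β r c ℱ X Pr = ψ := by
  funext z
  rw [← congrFun hQ z, continuationValue, hW.valueFn_eq hX hβ hβa hψ hQ, jovanovic]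

end WeightBounds

end Verification

end OptimalTiming

theorem theorem1 {Z : Type*} [MeasurableSpace Z] {Ω : Type*} [mΩ : MeasurableSpace Ω]
    -- the Markov state process and its transition kernel
    (P : Kernel Z Z) [IsMarkovKernel P] (ℱ : Filtration ℕ mΩ) (X : ℕ → Ω → Z)
    (Pr : Z → Measure Ω) (hX : IsMarkovFamily P ℱ X Pr)
    -- the discount factor and the payoffs
    (β : ℝ) (hβ0 : 0 < β) (hβ1 : β < 1)
    (r c : Z → ℝ) (hr : Measurable r) (hc : Measurable c)
    -- the drift condition
    (g : Z → ℝ) (n : ℕ) (m d : ℝ) (hdrift : DriftCondition P β r c g n m d)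
    -- the parameters of the weight function, and its finiteness
    (m' d' : ℝ) (hm' : 0 < m') (hd' : 0 < d') (hm1 : 1 < m + 2 * m')
    (hβm : β * (m + 2 * m') < 1) (hd : d / (m + 2 * m' - 1) ≤ d')
    (hfin : ∀ z, ∀ t ∈ Finset.Ico 1 n, absMoment P r t z ≠ ∞ ∧ absMoment P c t z ≠ ∞) :
    let ℓ : Z → ℝ := weight P r c g n m' d'
    let Q : (Z → ℝ) → (Z → ℝ) := jovanovic P β r c
    let v : Z → ℝ := valueFn β r c ℱ X Pr
    let ψ : Z → ℝ := continuationValue P β r c ℱ X Pr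
    let σ : Z → Fin 2 := thresholdPolicy r ψ
    -- the expectations, suprema and integrals that occur are well defined and finite
    ((∀ z τ, IsStoppingTime ℱ τ → Integrable (payoff β r c X τ) (Pr z)) ∧
      (∀ z, ∀ᵐ ω ∂(Pr z), Summable fun t : ℕ => β ^ t * c (X t ω)) ∧
      (∀ z, IsLUB (attainableValues β r c ℱ X Pr z) (v z)) ∧
      (∀ z, Integrable v (P z)) ∧
      (∀ f ∈ weightedBounded ℓ, ∀ z, Integrable (fun z' => max (r z') (f z')) (P z))) ∧
    -- 1. `Q` is a contraction of modulus `β (m + 2 m')`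
    ((∀ f ∈ weightedBounded ℓ, Q f ∈ weightedBounded ℓ) ∧
      (∀ f ∈ weightedBounded ℓ, ∀ h ∈ weightedBounded ℓ,
        weightedNorm ℓ (Q f - Q h) ≤ β * (m + 2 * m') * weightedNorm ℓ (f - h))) ∧
    -- 2. the continuation value function is the unique fixed point of `Q`
    (ψ ∈ weightedBounded ℓ ∧ Q ψ = ψ ∧ ∀ f ∈ weightedBounded ℓ, Q f = f → f = ψ) ∧
    -- 3. the policy `σ` is optimal: its stopping rule attains the value function and is
    -- unimproved by any stopping time, finite or not; it is an optimal policy in the class of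
    -- finite stopping times as soon as it stops almost surely
    (IsStoppingTime ℱ (policyTime X σ) ∧
      (∀ z, ∫ ω, payoff β r c X (policyTime X σ) ω ∂(Pr z) = v z) ∧
      (∀ z τ, IsStoppingTime ℱ τ → ∫ ω, payoff β r c X τ ω ∂(Pr z) ≤ v z) ∧
      ((∀ z, ∀ᵐ ω ∂(Pr z), policyTime X σ ω ≠ ⊤) → IsOptimalPolicy β r c ℱ X Pr σ)) := by
  intro ℓ Q v ψ σ
  have hW : WeightBounds P r c ℓ _ (m + 2 * m') :=
    hdrift.weightBounds hr hc hm' hd' hm1 hd hfin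
  obtain ⟨f, hf, hQf⟩ := hW.exists_jovanovic_eq hβ0.le hβm
  have hψ : ψ = f := hW.continuationValue_eq hX hβ0.le hβm hf hQf
  have hv : v = fun z => max (r z) (f z) := hW.valueFn_eq hX hβ0.le hβm hf hQf
  have hτ : IsStoppingTime ℱ (policyTime X σ) :=
    isStoppingTime_policyTime_threshold hX hr (hψ ▸ hf.1)
  have hval : ∀ z, ∫ ω, payoff β r c X (policyTime X σ) ω ∂(Pr z) = v z := fun z => by
    simp only [σ, hψ, hv]
    exact hW.integral_payoff_policyTime hX hβ0.le hβm hf hQf z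
  refine ⟨⟨fun z τ hτ => hW.integrable_payoff hX hβ0.le hβm hτ z,
      hW.ae_summable_flow hX hβ0.le hβm, fun z => ?_, fun z => ?_, fun h hh => hW.integrable_max hh⟩,
    ⟨fun h hh => hW.jovanovic_mem hβ0.le hh,
      fun h hh k hk => hW.weightedNorm_jovanovic_sub_le hβ0.le hh hk⟩,
    ⟨hψ ▸ hf, hψ ▸ hQf, fun h hh hQh => hψ ▸ hW.eq_of_jovanovic_eq hβ0.le hβm hh hf hQh hQf⟩,
    hτ, hval, fun z τ hτ => ?_, fun hfinite => ⟨⟨hτ, hfinite⟩, hval⟩⟩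
  · rw [hv]
    exact hW.isLUB_attainableValues hX hβ0.le hβm hf hQf z
  · rw [hv]
    exact hW.integrable_max hf z
  · rw [hv]
    exact hW.integral_payoff_le hX hβ0.le hβm hf hQf hτ z
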